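/- Fix $n\ge 2$ items and write $[n]=\{1,\dots,n\}$. A valuation is a function $v:2^{[n]}\to\mathbb{R}_{\ge 0}$ that is monotone ($v(S)\le v(T)$ for $S\subseteq T$) and satisfies $v(\emptyset)=0$; a distribution over valuations is a Borel probability measure on the set of valuations. A lottery is a pair $(x,p)$ of a probability distribution $x$ over subsets of $[n]$ and a price $p\ge 0$. In a buy-many mechanism given by a set $\Lambda$ of lotteries, the buyer may adaptively buy a (finite or infinite) sequence of lotteries from $\Lambda$, choosing at each point to stop or which lottery to buy next depending on the sets realized so far; he receives the union of all realized sets and pays the sum of the prices. A buyer of type $v$ uses an adaptive strategy that maximizes his expected value for the union minus his expected payment, and it is part of the mechanism that such a maximizer exists for every type and which one is used (with the expected payment measurable in $v$). The revenue of the mechanism under a distribution $D$ is the expected payment of the buyer when $v\sim D$, and $\mathrm{BuyManyRev}(D)\in[0,\infty]$ is the supremum of the revenues under $D$ of all buy-many mechanisms. For $\varepsilon\ge 0$, a distribution $D'$ is a $(1\pm\varepsilon)$-multiplicative perturbation of $D$ if there is a coupling $(v,v')$ of $D$ and $D'$ such that, almost surely, $(1-\varepsilon)v(S)\le v'(S)\le(1+\varepsilon)v(S)$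 for every $S\subseteq[n]$. Theorem. There is an absolute constant $C>0$ such that for every $n\ge 2$, every $\varepsilon\ge 0$, every distribution $D$ over valuations on $[n]$ and every $(1\pm\varepsilon)$-multiplicative perturbation $D'$ of $D$ (also a distribution over valuations), $$\mathrm{BuyManyRev}(D')\ \ge\ \max\left\{0,\;1-C\,\varepsilon^{1/6}\,n^{1/2}\,(\log n)^{1/6}\right\}\cdot \mathrm{BuyManyRev}(D),$$ with the convention $0\cdot\infty=0$. -/

import Mathlib

open MeasureTheory
open scoped ENNReal NNReal

noncomputable section

namespace BuyMany

/-- A buyer type over the items `Fin n`: a non-negative, monotone set function, normalized so that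
receiving no item is worth nothing. It carries the Borel (product) sigma-algebra, as a subtype
of the functions from item sets to the non-negative reals. -/
abbrev Valuation (n : ℕ) : Type :=
  {v : Finset (Fin n) → ℝ≥0 // Monotone v ∧ v ∅ = 0}

/-- A lottery: a random set of items together with a price. -/
structure Lottery (n : ℕ) where
  /-- the distribution of the set of items that is handed over -/
  alloc : PMF (Finset (Fin n))
  /-- the price charged for the lottery -/
  price : ℝ≥0

/-- The sets of items that were obtained in the purchases made so far, the latest one first. -/
abbrev History (n : ℕ) : Type := List (Finset (Fin n))

/-- The union of all items obtained so far. -/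
def History.items {n : ℕ} (h : History n) : Finset (Fin n) :=
  h.foldr (· ∪ ·) ∅

/-- An adaptive purchasing strategy: after each history of realized sets, it either stops (`none`)
or buys a further lottery. The number of purchases need not be bounded. -/
def Strategy (n : ℕ) : Type := History n → Option (Lottery n)

namespace Strategy

variable {n : ℕ}

/-- The strategy only buys lotteries of the given menu. -/
def BuysFrom (A : Strategy n) (menu : Set (Lottery n)) : Prop :=
  ∀ (h : History n) (l : Lottery n), A h = some l → l ∈ menu

/-- One round: stop for good, or buy the prescribed lottery, draw a set from it independently of
the past, and record the set. -/
def step (A : Strategy n) (h : History n) : PMF (History n) :=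
  (A h).elim (PMF.pure h) fun l => l.alloc.map fun S => S :: h

/-- The distribution of the history after `k` rounds. -/
def run (A : Strategy n) : ℕ → PMF (History n)
  | 0 => PMF.pure []
  | k + 1 => (A.run k).bind A.step

/-- The price of the lottery that is bought next after the history `h` (zero if none is). -/
def nextPrice (A : Strategy n) (h : History n) : ℝ≥0∞ :=
  (A h).elim 0 fun l => (l.price : ℝ≥0∞)

/-- The expected sum of the prices of all lotteries bought (possibly infinite). -/
def expectedPayment (A : Strategy n) : ℝ≥0∞ :=
  ∑' k : ℕ, ∑' h : History n, A.run k h * A.nextPrice h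

/-- The expected value of the union of all items obtained. The union after `k` rounds grows with
`k` and `v` is monotone, so that the supremum is the limit `k → ∞`, which by monotone convergence
is the expectation of `v` at the union over all rounds. -/
def expectedValue (v : Valuation n) (A : Strategy n) : ℝ≥0∞ :=
  ⨆ k : ℕ, ∑' h : History n, A.run k h * (v.1 h.items : ℝ≥0∞)

/-- Quasi-linear expected utility. The expected value is finite, so that this is `⊥` exactly
for a strategy of infinite expected payment. -/
def utility (v : Valuation n) (A : Strategy n) : EReal :=
  (A.expectedValue v : EReal) - (A.expectedPayment : EReal)

end Strategy

/-- A buy-many mechanism: a menu of lotteries, from which the buyer may buy adaptively and as often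
as he likes, and for each buyer type a utility-maximizing adaptive strategy (which fixes how ties
are broken), such that the expected payment is a measurable function of the type. -/
structure Mechanism (n : ℕ) where
  menu : Set (Lottery n)
  choice : Valuation n → Strategy n
  choice_buysFrom : ∀ v, (choice v).BuysFrom menu
  choice_optimal : ∀ (v : Valuation n) (A : Strategy n), A.BuysFrom menu →
    A.utility v ≤ (choice v).utility v
  measurable_payment : Measurable fun v => (choice v).expectedPayment

/-- The expected revenue of a mechanism when the type is drawn from `D`. -/
def Mechanism.revenue {n : ℕ} (M : Mechanism n) (D : Measure (Valuation n)) : ℝ≥0∞ :=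
  ∫⁻ v, (M.choice v).expectedPayment ∂D

/-- The optimal revenue of buy-many mechanisms (possibly infinite). -/
def buyManyRev {n : ℕ} (D : Measure (Valuation n)) : ℝ≥0∞ :=
  ⨆ M : Mechanism n, M.revenue D

/-- `D'` is a `(1 ± ε)`-multiplicative perturbation of `D`: there is a coupling `π` of the two
under which, almost surely, all values change by a factor between `1 - ε` and `1 + ε`. -/
def IsMultiplicativePerturbation {n : ℕ} (ε : ℝ) (D D' : Measure (Valuation n)) : Prop :=
  ∃ π : Measure (Valuation n × Valuation n),
    π.map Prod.fst = D ∧ π.map Prod.snd = D' ∧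
      ∀ᵐ z ∂π, ∀ S : Finset (Fin n),
        (1 - ε) * (z.1.1 S : ℝ) ≤ (z.2.1 S : ℝ) ∧ (z.2.1 S : ℝ) ≤ (1 + ε) * (z.1.1 S : ℝ)

end BuyMany

end

/-! Take a mechanism `M` for `D` and sell to `D'` with all prices of `M` multiplied by `1 - δ`. The
discount favours strategies with a high payment: adding the optimality conditions of `v` at the old
prices and of `v'` at the new ones bounds the drop in (undiscounted) payment by `(2ε/δ) v([n])`.

This error must be compared with revenue, although the mean of `v([n])` may be infinite. Let `p_i`
be the least cost per unit of probability of getting item `i` from the menu, and `k = n/δ`. If some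
`p_i` satisfies `p_i ≤ 2n v([n])` and `v([n]) ≤ k p_i`, the error is at most `(2ε/δ) k p_i` on the
event `p_i ≤ 2n v([n])`. Otherwise every item is too expensive to matter (`p_i > 2n v([n])`) or very
cheap (`k p_i < v([n])`); as all cheap items can be collected one by one, the type pays at most
twice the sum of the cheap `p_i`.

Either way the loss is a sum over items of a constant times the indicator that `v([n])` exceeds a
threshold. Selling the grand bundle gives `t · Pr[v'([n]) ≥ t] ≤ BuyManyRev(D')`, so the total loss
is `O(ε n³/δ² + δ) · BuyManyRev(D')`, which is `O(δ)` times it once `ε n³ ≤ δ³`. With `δ = ε^(1/3)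
n` this is stronger than the claim wherever the claimed factor is positive.

The carrying lemmas are `payment_le_payment_scale_add`, `payment_le_two_mul_sum`,
`mul_measure_le_buyManyRev` and `revenue_le_buyManyRev_add`. -/

noncomputable section

namespace BuyMany

/-! ### Expectations under discrete distributions -/

/-- The expectation of a function with values in `[0, ∞]` under a discrete distribution. -/
def pmfExp {α : Type*} (p : PMF α) (f : α → ℝ≥0∞) : ℝ≥0∞ := ∑' a, p a * f a

section pmfExp

variable {α β : Type*}

lemma pmfExp_const (p : PMF α) (c : ℝ≥0∞) : pmfExp p (fun _ => c) = c := by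
  simp [pmfExp, ENNReal.tsum_mul_right, p.tsum_coe]

lemma pmfExp_mono (p : PMF α) {f g : α → ℝ≥0∞} (h : ∀ a, f a ≤ g a) :
    pmfExp p f ≤ pmfExp p g :=
  ENNReal.tsum_le_tsum fun a => mul_le_mul_right (h a) _

lemma pmfExp_add (p : PMF α) (f g : α → ℝ≥0∞) :
    pmfExp p (fun a => f a + g a) = pmfExp p f + pmfExp p g := by
  simp only [pmfExp, mul_add, ENNReal.tsum_add]

lemma pmfExp_const_mul (p : PMF α) (c : ℝ≥0∞) (f : α → ℝ≥0∞) :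
    pmfExp p (fun a => c * f a) = c * pmfExp p f := by
  simp only [pmfExp, ← ENNReal.tsum_mul_left]
  exact tsum_congr fun a => by ring

lemma pmfExp_finsetSum {ι : Type*} (p : PMF α) (s : Finset ι) (f : ι → α → ℝ≥0∞) :
    pmfExp p (fun a => ∑ i ∈ s, f i a) = ∑ i ∈ s, pmfExp p (f i) := by
  classical
  induction s using Finset.induction_on with
  | empty => simp [pmfExp]
  | insert i s hi ih => simp only [Finset.sum_insert hi, pmfExp_add, ih]

lemma pmfExp_pure (a : α) (f : α → ℝ≥0∞) : pmfExp (PMF.pure a) f = f a := by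
  rw [pmfExp, tsum_eq_single a]
  · simp
  · intro b hb
    simp [hb]

lemma pmfExp_bind (p : PMF α) (q : α → PMF β) (f : β → ℝ≥0∞) :
    pmfExp (p.bind q) f = pmfExp p fun a => pmfExp (q a) f := by
  simp only [pmfExp, PMF.bind_apply, ← ENNReal.tsum_mul_right, ← ENNReal.tsum_mul_left]
  rw [ENNReal.tsum_comm]
  exact tsum_congr fun a => tsum_congr fun b => by ring

lemma pmfExp_map (p : PMF α) (g : α → β) (f : β → ℝ≥0∞) :
    pmfExp (p.map g) f = pmfExp p fun a => f (g a) := by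
  rw [← PMF.bind_pure_comp, pmfExp_bind]
  simp [pmfExp_pure]

end pmfExp

lemma History.items_cons {n : ℕ} (S : Finset (Fin n)) (h : History n) :
    History.items (S :: h) = S ∪ h.items := rfl

lemma History.items_nil {n : ℕ} : History.items ([] : History n) = ∅ := rfl

/-- The probability that a lottery hands over a given item. -/
def Lottery.prob {n : ℕ} (l : Lottery n) (i : Fin n) : ℝ≥0∞ :=
  pmfExp l.alloc fun S => if i ∈ S then 1 else 0

lemma Lottery.prob_le_one {n : ℕ} (l : Lottery n) (i : Fin n) : l.prob i ≤ 1 := by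
  refine (pmfExp_mono _ (g := fun _ => 1) fun S => ?_).trans_eq (pmfExp_const _ _)
  split_ifs <;> simp

/-- The valuation multiplied by a constant. -/
def Valuation.scale {n : ℕ} (c : ℝ≥0) (v : Valuation n) : Valuation n :=
  ⟨fun S => c * v.1 S, fun _ _ h => mul_le_mul_right (v.2.1 h) c, by simp [v.2.2]⟩

lemma Valuation.measurable_apply {n : ℕ} (S : Finset (Fin n)) :
    Measurable fun v : Valuation n => v.1 S :=
  (measurable_pi_apply S).comp measurable_subtype_coe

lemma Valuation.measurable_scale {n : ℕ} (c : ℝ≥0) :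
    Measurable (Valuation.scale c : Valuation n → Valuation n) := by
  refine Measurable.subtype_mk (measurable_pi_lambda _ fun S => ?_)
  exact (Valuation.measurable_apply S).const_mul c

/-! ### Potential arguments and utilities of strategies -/

namespace Strategy

variable {n : ℕ}

lemma pmfExp_step_none {A : Strategy n} {h : History n} (hA : A h = none)
    (f : History n → ℝ≥0∞) : pmfExp (A.step h) f = f h := by
  simp [step, hA, pmfExp_pure]

lemma pmfExp_step_some {A : Strategy n} {h : History n} {l : Lottery n} (hA : A h = some l)
    (f : History n → ℝ≥0∞) :
    pmfExp (A.step h) f = pmfExp l.alloc fun S => f (S :: h) := by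
  simp [step, hA, pmfExp_map]

lemma expectedPayment_eq (A : Strategy n) :
    A.expectedPayment = ∑' k, pmfExp (A.run k) A.nextPrice := rfl

lemma expectedValue_eq (v : Valuation n) (A : Strategy n) :
    A.expectedValue v = ⨆ k, pmfExp (A.run k) fun h => (v.1 h.items : ℝ≥0∞) := rfl

lemma pmfExp_run_succ (A : Strategy n) (k : ℕ) (f : History n → ℝ≥0∞) :
    pmfExp (A.run (k + 1)) f = pmfExp (A.run k) fun h => pmfExp (A.step h) f :=
  pmfExp_bind _ _ _

/-- A function that pays for its running cost by its expected decrease bounds the total cost. -/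
lemma tsum_le_of_potential (A : Strategy n) (g Φ : History n → ℝ≥0∞)
    (hΦ : ∀ h, g h + pmfExp (A.step h) Φ ≤ Φ h) :
    ∑' k, pmfExp (A.run k) g ≤ Φ [] := by
  -- Telescoping: the cost so far plus the expected remaining potential never exceeds the initial
  -- potential.
  have key : ∀ K, ∑ k ∈ Finset.range K, pmfExp (A.run k) g + pmfExp (A.run K) Φ ≤ Φ [] := by
    intro K
    induction K with
    | zero => simp [run, pmfExp_pure]
    | succ K ih =>
      rw [Finset.sum_range_succ, add_assoc, pmfExp_run_succ, ← pmfExp_add]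
      exact (add_le_add_right (pmfExp_mono _ hΦ) _).trans ih
  exact ENNReal.tsum_le_of_sum_range_le fun K => le_self_add.trans (key K)

/-- A function whose expected increase is at most the price paid stays below the payment. -/
lemma pmfExp_run_le_expectedPayment (A : Strategy n) (f : History n → ℝ≥0∞) (h0 : f [] = 0)
    (hf : ∀ h, pmfExp (A.step h) f ≤ f h + A.nextPrice h) (k : ℕ) :
    pmfExp (A.run k) f ≤ A.expectedPayment := by
  have key : ∀ K, pmfExp (A.run K) f ≤ ∑ k ∈ Finset.range K, pmfExp (A.run k) A.nextPrice := by
    intro K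
    induction K with
    | zero => simp [run, pmfExp_pure, h0]
    | succ K ih =>
      rw [Finset.sum_range_succ, pmfExp_run_succ]
      refine (pmfExp_mono _ hf).trans ?_
      rw [pmfExp_add]
      exact add_le_add_left ih _
  exact (key k).trans (ENNReal.sum_le_tsum _)

lemma expectedValue_le_mul {v w : Valuation n} (c : ℝ≥0) (hvw : ∀ S, v.1 S ≤ c * w.1 S)
    (A : Strategy n) : A.expectedValue v ≤ c * A.expectedValue w := by
  rw [expectedValue_eq, expectedValue_eq, ENNReal.mul_iSup]
  refine iSup_mono fun k => ?_
  rw [← pmfExp_const_mul]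
  exact pmfExp_mono _ fun h => by exact_mod_cast hvw h.items

lemma expectedValue_scale (c : ℝ≥0) (v : Valuation n) (A : Strategy n) :
    A.expectedValue (v.scale c) = c * A.expectedValue v := by
  rw [expectedValue_eq, expectedValue_eq, ENNReal.mul_iSup]
  simp only [← pmfExp_const_mul, Valuation.scale, ENNReal.coe_mul]

lemma expectedValue_le (v : Valuation n) (A : Strategy n) :
    A.expectedValue v ≤ v.1 Finset.univ := by
  rw [expectedValue_eq]
  refine iSup_le fun k => ?_
  refine (pmfExp_mono _ (g := fun _ => (v.1 Finset.univ : ℝ≥0∞)) fun h => ?_).trans_eq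
    (pmfExp_const _ _)
  exact_mod_cast v.2.1 (Finset.subset_univ _)

lemma expectedValue_ne_top (v : Valuation n) (A : Strategy n) : A.expectedValue v ≠ ⊤ :=
  ne_top_of_le_ne_top ENNReal.coe_ne_top (expectedValue_le v A)

/-- Replaces differences in `EReal` by sums in `ℝ≥0∞`. An infinite payment of `A` is harmless: the
left side is then `⊥` and the right-hand inequality is trivial. -/
lemma utility_le_utility_iff {v : Valuation n} {A B : Strategy n} (hB : B.expectedPayment ≠ ⊤) :
    A.utility v ≤ B.utility v ↔
      A.expectedValue v + B.expectedPayment ≤ B.expectedValue v + A.expectedPayment := by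
  have hA' := expectedValue_ne_top v A
  have hB' := expectedValue_ne_top v B
  unfold utility
  lift A.expectedValue v to ℝ≥0 using hA' with a
  lift B.expectedValue v to ℝ≥0 using hB' with b
  lift B.expectedPayment to ℝ≥0 using hB with q
  rcases eq_or_ne A.expectedPayment ⊤ with h | h
  · simp [h, EReal.sub_top]
  · lift A.expectedPayment to ℝ≥0 using h with p
    have e1 : (((a : ℝ≥0∞) : EReal) - ((p : ℝ≥0∞) : EReal)) = (((a : ℝ) - p : ℝ) : EReal) := rfl
    have e2 : (((b : ℝ≥0∞) : EReal) - ((q : ℝ≥0∞) : EReal)) = (((b : ℝ) - q : ℝ) : EReal) := rfl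
    rw [e1, e2, EReal.coe_le_coe_iff]
    norm_cast
    rw [← NNReal.coe_le_coe]
    push_cast
    constructor <;> intro h <;> linarith

/-- The strategy that never buys anything. -/
def idle (n : ℕ) : Strategy n := fun _ => none

lemma expectedPayment_idle : (idle n).expectedPayment = 0 := by
  have : (idle n).nextPrice = fun _ => 0 := rfl
  simp [expectedPayment_eq, this, pmfExp_const]

lemma run_eq_pure_of_nil_eq_none {A : Strategy n} (hA : A [] = none) (k : ℕ) :
    A.run k = PMF.pure [] := by
  induction k with
  | zero => rfl
  | succ k ih => simp [run, ih, step, hA]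

lemma expectedValue_idle (v : Valuation n) : (idle n).expectedValue v = 0 := by
  simp [expectedValue_eq, run_eq_pure_of_nil_eq_none (A := idle n) rfl, pmfExp_pure,
    History.items_nil, v.2.2]

end Strategy

/-! ### Item prices of a mechanism -/

namespace Mechanism

open Strategy

variable {n : ℕ} (M : Mechanism n)

/-- The expected payment of a type. -/
def payment (v : Valuation n) : ℝ≥0∞ := (M.choice v).expectedPayment

/-- Buying nothing has utility `0`, whereas an infinite payment has utility `⊥`. -/
lemma payment_ne_top (v : Valuation n) : M.payment v ≠ ⊤ := by
  intro h
  have h1 := M.choice_optimal v (idle n) (fun _ _ h => by simp [idle] at h)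
  have h2 : (M.choice v).expectedPayment = ⊤ := h
  simp [utility, h2, expectedPayment_idle, expectedValue_idle] at h1

lemma expectedValue_add_payment_le (v : Valuation n) {A : Strategy n} (hA : A.BuysFrom M.menu) :
    A.expectedValue v + M.payment v ≤ (M.choice v).expectedValue v + A.expectedPayment :=
  (utility_le_utility_iff (M.payment_ne_top v)).1 (M.choice_optimal v A hA)

/-- The price of an item: the least cost per unit of probability of obtaining it. -/
def itemPrice (i : Fin n) : ℝ≥0∞ :=
  ⨅ l ∈ {l ∈ M.menu | l.prob i ≠ 0}, (l.price : ℝ≥0∞) / l.prob i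

lemma itemPrice_mul_prob_le (i : Fin n) {l : Lottery n} (hl : l ∈ M.menu) {c : ℝ≥0∞}
    (hc : c ≤ M.itemPrice i) : c * l.prob i ≤ l.price := by
  by_cases h : l.prob i = 0
  · simp [h]
  · have : M.itemPrice i ≤ (l.price : ℝ≥0∞) / l.prob i := iInf₂_le l ⟨hl, h⟩
    exact (ENNReal.le_div_iff_mul_le (Or.inl h)
      (Or.inl (ne_top_of_le_ne_top ENNReal.one_ne_top (l.prob_le_one i)))).1 (hc.trans this)

lemma exists_lottery_of_itemPrice_lt (i : Fin n) {c : ℝ≥0∞} (hc : M.itemPrice i < c) :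
    ∃ l ∈ M.menu, l.prob i ≠ 0 ∧ l.price ≤ c * l.prob i := by
  obtain ⟨l, hl, h⟩ := by simpa only [itemPrice, iInf_lt_iff] using hc
  obtain ⟨hl, h0⟩ := hl
  exact ⟨l, hl, h0, (ENNReal.div_le_iff_le_mul (Or.inl h0)
    (Or.inl (ne_top_of_le_ne_top ENNReal.one_ne_top (l.prob_le_one i)))).1 h.le⟩

end Mechanism

/-! ### Obtaining items at their item prices -/

namespace Strategy

variable {n : ℕ}

/-- The probability of holding an item after `k` rounds is bounded by payment over price. -/
lemma mul_pmfExp_mem_le (M : Mechanism n) {A : Strategy n} (hA : A.BuysFrom M.menu) (i : Fin n)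
    {c : ℝ≥0∞} (hc : c ≤ M.itemPrice i) (k : ℕ) :
    c * pmfExp (A.run k) (fun h => if i ∈ h.items then 1 else 0) ≤ A.expectedPayment := by
  rw [← pmfExp_const_mul]
  refine pmfExp_run_le_expectedPayment A _ (by simp [History.items_nil]) (fun h => ?_) k
  rcases hl : A h with _ | l
  · rw [pmfExp_step_none hl]
    exact le_self_add
  · rw [pmfExp_step_some hl]
    have h1 : A.nextPrice h = l.price := by simp [nextPrice, hl]
    have h2 := M.itemPrice_mul_prob_le i (hA h l hl) hc
    rw [h1]
    refine le_trans ?_ (add_le_add_right h2 _)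
    rw [Lottery.prob, ← pmfExp_const_mul, ← pmfExp_const (l.alloc) (c * _), ← pmfExp_add]
    refine pmfExp_mono _ fun S => ?_
    rw [← mul_add]
    gcongr
    rw [History.items_cons]
    by_cases h3 : i ∈ S <;> by_cases h4 : i ∈ h.items <;> simp [h3, h4]

/-- Buy the lottery of some missing item of `C` until all of `C` has been collected. -/
def collect (C : Finset (Fin n)) (l : Fin n → Lottery n) : Strategy n := fun h =>
  if hC : (C \ h.items).Nonempty then some (l ((C \ h.items).min' hC)) else none

/-- The potential is the sum of `c i` over the missing items of `C`; buying `l i` lowers it in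
expectation by at least `c i` times the probability of `i`. It is used with `g` the price, and with
`g` the indicator that `C` is incomplete. -/
lemma collect_tsum_le (C : Finset (Fin n)) (l : Fin n → Lottery n) (c : Fin n → ℝ≥0∞)
    (g : History n → ℝ≥0∞)
    (hg : ∀ h i, i ∈ C → collect C l h = some (l i) → g h ≤ c i * (l i).prob i)
    (hg0 : ∀ h, collect C l h = none → g h = 0) :
    ∑' k, pmfExp ((collect C l).run k) g ≤ ∑ i ∈ C, c i := by
  refine (tsum_le_of_potential (collect C l) g
    (fun h => ∑ i ∈ C, if i ∈ h.items then 0 else c i) fun h => ?_).trans_eq ?_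
  · by_cases hC : (C \ h.items).Nonempty
    · obtain ⟨hi, hi'⟩ := Finset.mem_sdiff.1 ((C \ h.items).min'_mem hC)
      have hs : collect C l h = some (l ((C \ h.items).min' hC)) := by simp [collect, hC]
      generalize (C \ h.items).min' hC = i at hi hi' hs
      rw [pmfExp_step_some hs]
      refine (add_le_add_left (hg h i hi hs) _).trans ?_
      rw [Lottery.prob, ← pmfExp_const_mul, ← pmfExp_add]
      refine (pmfExp_mono _ fun S => ?_).trans_eq (pmfExp_const (l i).alloc _)
      rw [← Finset.add_sum_erase C _ hi, ← Finset.add_sum_erase C _ hi, ← add_assoc]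
      refine add_le_add ?_ (Finset.sum_le_sum fun j _ => ?_)
      · by_cases h3 : i ∈ S <;> simp [h3, hi', History.items_cons]
      · by_cases h3 : j ∈ S <;> by_cases h4 : j ∈ h.items <;> simp [h3, h4, History.items_cons]
    · have hs : collect C l h = none := by simp [collect, hC]
      rw [pmfExp_step_none hs, hg0 h hs, zero_add]
  · simp [History.items_nil]

lemma collect_expectedPayment_le (C : Finset (Fin n)) (l : Fin n → Lottery n) (c : Fin n → ℝ≥0∞)
    (hc : ∀ i ∈ C, (l i).price ≤ c i * (l i).prob i) :
    (collect C l).expectedPayment ≤ ∑ i ∈ C, c i := by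
  refine collect_tsum_le C l c _ (fun h i hi hs => ?_) fun h hs => by simp [nextPrice, hs]
  simpa [nextPrice, hs] using hc i hi

/-- With `c i` the inverse probability, the expected number of purchases is finite, so the
probability that `C` is still incomplete tends to zero. -/
lemma le_collect_expectedValue (v : Valuation n) (C : Finset (Fin n)) (l : Fin n → Lottery n)
    (hl : ∀ i ∈ C, (l i).prob i ≠ 0) :
    (v.1 C : ℝ≥0∞) ≤ (collect C l).expectedValue v := by
  set g : History n → ℝ≥0∞ := fun h => if C ⊆ h.items then 0 else 1 with hg
  have h1 : ∑' k, pmfExp ((collect C l).run k) g ≠ ⊤ := by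
    refine ne_top_of_le_ne_top ?_
      (collect_tsum_le C l (fun i => ((l i).prob i)⁻¹) g (fun h i hi _ => ?_) fun h hs => ?_)
    · exact (ENNReal.sum_lt_top.2 fun i hi => by simpa [pos_iff_ne_zero] using hl i hi).ne
    · rw [ENNReal.inv_mul_cancel (hl i hi)
        (ne_top_of_le_ne_top ENNReal.one_ne_top ((l i).prob_le_one i))]
      simp only [hg]
      split_ifs <;> simp
    · by_cases hC : (C \ h.items).Nonempty
      · simp [collect, hC] at hs
      · rw [Finset.not_nonempty_iff_eq_empty, Finset.sdiff_eq_empty_iff_subset] at hC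
        simp [hg, hC]
  have h2 := ENNReal.tendsto_atTop_zero_of_tsum_ne_top h1
  have h3 : ∀ k, (v.1 C : ℝ≥0∞) ≤
      (collect C l).expectedValue v + v.1 C * pmfExp ((collect C l).run k) g := by
    intro k
    rw [← pmfExp_const ((collect C l).run k) (v.1 C : ℝ≥0∞), ← pmfExp_const_mul]
    refine le_trans ?_ (add_le_add_left (le_iSup (fun k => pmfExp ((collect C l).run k)
      fun h => (v.1 h.items : ℝ≥0∞)) k) _)
    rw [← pmfExp_add]
    refine pmfExp_mono _ fun h => ?_
    by_cases hC : C ⊆ h.items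
    · have : v.1 C ≤ v.1 h.items := v.2.1 hC
      exact le_add_right (by exact_mod_cast this)
    · simp [hg, hC, pmfExp_const]
  have h4 : Filter.Tendsto (fun k => (collect C l).expectedValue v +
      v.1 C * pmfExp ((collect C l).run k) g) Filter.atTop
      (nhds ((collect C l).expectedValue v + v.1 C * 0)) :=
    (ENNReal.Tendsto.const_mul h2 (Or.inr ENNReal.coe_ne_top)).const_add _
  simpa using ge_of_tendsto' h4 h3

end Strategy

/-! ### Rescaling prices -/

/-- The lottery with its price multiplied by a constant. -/
def Lottery.scale {n : ℕ} (c : ℝ≥0) (l : Lottery n) : Lottery n := ⟨l.alloc, c * l.price⟩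

lemma Lottery.scale_scale {n : ℕ} (c d : ℝ≥0) (l : Lottery n) :
    (l.scale d).scale c = l.scale (c * d) := by
  simp [Lottery.scale, mul_assoc]

lemma Lottery.scale_one {n : ℕ} (l : Lottery n) : l.scale 1 = l := by
  simp [Lottery.scale]

namespace Strategy

variable {n : ℕ}

/-- The strategy that buys the rescaled lotteries. -/
def scale (c : ℝ≥0) (A : Strategy n) : Strategy n := fun h => (A h).map (Lottery.scale c)

lemma run_scale (c : ℝ≥0) (A : Strategy n) (k : ℕ) : (A.scale c).run k = A.run k := by
  have : (A.scale c).step = A.step := by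
    funext h
    cases hA : A h <;> simp [step, scale, hA, Lottery.scale]
  induction k with
  | zero => rfl
  | succ k ih => simp only [run, ih, this]

lemma expectedValue_scaled (c : ℝ≥0) (v : Valuation n) (A : Strategy n) :
    (A.scale c).expectedValue v = A.expectedValue v := by
  simp only [expectedValue_eq, run_scale]

lemma expectedPayment_scale (c : ℝ≥0) (A : Strategy n) :
    (A.scale c).expectedPayment = c * A.expectedPayment := by
  have : (A.scale c).nextPrice = fun h => c * A.nextPrice h := by
    funext h
    cases hA : A h <;> simp [nextPrice, scale, hA, Lottery.scale]
  simp only [expectedPayment_eq, run_scale, this, pmfExp_const_mul, ENNReal.tsum_mul_left]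

end Strategy

namespace Mechanism

open Strategy

variable {n : ℕ}

/-- The mechanism with all prices multiplied by a positive constant. -/
def scale (c : ℝ≥0) (hc : c ≠ 0) (M : Mechanism n) : Mechanism n where
  menu := Lottery.scale c '' M.menu
  -- At prices multiplied by `c`, type `v` faces the problem of type `v / c` at the old prices, so
  -- maximizers and measurability are inherited from `M`.
  choice v := (M.choice (v.scale c⁻¹)).scale c
  choice_buysFrom v h l hl := by
    obtain ⟨l', hl', rfl⟩ := Option.map_eq_some_iff.1 hl
    exact ⟨l', M.choice_buysFrom _ h l' hl', rfl⟩
  choice_optimal v A hA := by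
    have hB : (A.scale c⁻¹).BuysFrom M.menu := by
      intro h l hl
      obtain ⟨l', hl', rfl⟩ := Option.map_eq_some_iff.1 hl
      obtain ⟨l'', hl'', rfl⟩ := hA h l' hl'
      rwa [Lottery.scale_scale, inv_mul_cancel₀ hc, Lottery.scale_one]
    have hfin := M.payment_ne_top (v.scale c⁻¹)
    rw [payment] at hfin
    rw [utility_le_utility_iff
      (by rw [expectedPayment_scale]; exact ENNReal.mul_ne_top ENNReal.coe_ne_top hfin)]
    have h1 := mul_le_mul_right (M.expectedValue_add_payment_le (v.scale c⁻¹) hB) (c : ℝ≥0∞)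
    have h2 : (c : ℝ≥0∞) * (c⁻¹ : ℝ≥0) = 1 := by
      rw [← ENNReal.coe_mul, mul_inv_cancel₀ hc, ENNReal.coe_one]
    simp only [mul_add, expectedValue_scale, expectedValue_scaled, expectedPayment_scale, payment,
      ← mul_assoc, h2, one_mul] at h1
    simpa only [expectedValue_scaled, expectedPayment_scale] using h1
  measurable_payment := by
    simp only [expectedPayment_scale]
    exact (M.measurable_payment.comp (Valuation.measurable_scale c⁻¹)).const_mul _

lemma payment_scale (c : ℝ≥0) (hc : c ≠ 0) (M : Mechanism n) (v : Valuation n) :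
    (M.scale c hc).payment v = c * M.payment (v.scale c⁻¹) :=
  expectedPayment_scale _ _

end Mechanism

/-! ### Selling the grand bundle -/

/-- The offer of all items at a fixed price. -/
def bundleLottery (n : ℕ) (t : ℝ≥0) : Lottery n := ⟨PMF.pure Finset.univ, t⟩

/-- Buy all items once. -/
def buyBundle (n : ℕ) (t : ℝ≥0) : Strategy n := fun h =>
  if h = [] then some (bundleLottery n t) else none

namespace Strategy

variable {n : ℕ}

lemma run_succ_buyBundle (t : ℝ≥0) (k : ℕ) :
    (buyBundle n t).run (k + 1) = PMF.pure [Finset.univ] := by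
  induction k with
  | zero => simp [run, step, buyBundle, bundleLottery, PMF.pure_map]
  | succ k ih =>
    rw [run, ih]
    simp [step, buyBundle]

lemma expectedPayment_buyBundle (t : ℝ≥0) : (buyBundle n t).expectedPayment = t := by
  rw [expectedPayment_eq, tsum_eq_single 0]
  · simp [run, pmfExp_pure, nextPrice, buyBundle, bundleLottery]
  · intro k hk
    obtain ⟨k, rfl⟩ := Nat.exists_eq_succ_of_ne_zero hk
    rw [Nat.succ_eq_add_one, run_succ_buyBundle]
    simp [pmfExp_pure, nextPrice, buyBundle]

lemma expectedValue_buyBundle (t : ℝ≥0) (v : Valuation n) :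
    (buyBundle n t).expectedValue v = v.1 Finset.univ := by
  refine le_antisymm (expectedValue_le v _) ?_
  rw [expectedValue_eq]
  refine le_trans ?_ (le_iSup _ 1)
  rw [show (1 : ℕ) = 0 + 1 from rfl, run_succ_buyBundle]
  simp [pmfExp_pure, History.items_cons, History.items_nil]

lemma expectedPayment_choose_buyBundle (t : ℝ≥0) (v : Valuation n) :
    (if t ≤ v.1 Finset.univ then buyBundle n t else idle n).expectedPayment =
      if t ≤ v.1 Finset.univ then (t : ℝ≥0∞) else 0 := by
  split_ifs
  · exact expectedPayment_buyBundle t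
  · exact expectedPayment_idle

end Strategy

open Strategy in
/-- The mechanism that sells only the set of all items, at a fixed price. -/
def bundleMechanism (n : ℕ) (t : ℝ≥0) : Mechanism n where
  menu := {bundleLottery n t}
  choice v := if t ≤ v.1 Finset.univ then buyBundle n t else idle n
  choice_buysFrom v h l hl := by
    split_ifs at hl
    · by_cases h0 : h = []
      · simpa [buyBundle, h0, eq_comm] using hl
      · simp [buyBundle, h0] at hl
    · simp [idle] at hl
  choice_optimal v A hA := by
    have hfin := expectedPayment_choose_buyBundle t v
    rw [utility_le_utility_iff (by rw [hfin]; split_ifs <;> simp)]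
    -- A strategy either never buys, or pays at least `t` for a value of at most `v([n])`.
    rcases hA0 : A [] with _ | l
    · have h1 : A.expectedValue v = 0 := by
        simp [expectedValue_eq, run_eq_pure_of_nil_eq_none hA0, pmfExp_pure, History.items_nil,
          v.2.2]
      rw [h1, zero_add, hfin]
      split_ifs with h
      · rw [expectedValue_buyBundle]
        exact le_add_right (by exact_mod_cast h)
      · exact zero_le
    · have hl : l = bundleLottery n t := hA [] l hA0
      have h1 : (t : ℝ≥0∞) ≤ A.expectedPayment := by
        rw [expectedPayment_eq]
        refine le_trans ?_ (ENNReal.le_tsum 0)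
        simp [run, pmfExp_pure, nextPrice, hA0, hl, bundleLottery]
      have h2 := expectedValue_le v A
      rw [hfin]
      split_ifs with h
      · rw [expectedValue_buyBundle]
        exact add_le_add h2 h1
      · rw [add_zero]
        refine h2.trans (le_trans ?_ (le_add_left h1))
        exact_mod_cast (not_le.1 h).le
  measurable_payment := by
    simp only [expectedPayment_choose_buyBundle]
    exact Measurable.ite (measurableSet_le measurable_const (Valuation.measurable_apply _))
      measurable_const measurable_const

/-- Selling all items at price `t` bounds the tail of the value of all items. -/
lemma mul_measure_le_buyManyRev {n : ℕ} (D : Measure (Valuation n)) (t : ℝ≥0) :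
    (t : ℝ≥0∞) * D {v | t ≤ v.1 Finset.univ} ≤ buyManyRev D := by
  refine le_trans (le_of_eq ?_) (le_iSup (fun M : Mechanism n => M.revenue D) (bundleMechanism n t))
  have h : MeasurableSet {v : Valuation n | t ≤ v.1 Finset.univ} :=
    measurableSet_le measurable_const (Valuation.measurable_apply _)
  have h1 : ∀ v, ((bundleMechanism n t).choice v).expectedPayment =
      Set.indicator {v : Valuation n | t ≤ v.1 Finset.univ} (fun _ => (t : ℝ≥0∞)) v := by
    intro v
    simp only [bundleMechanism, Strategy.expectedPayment_choose_buyBundle, Set.indicator_apply,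
      Set.mem_ofPred_eq]
  simp only [Mechanism.revenue, h1]
  rw [lintegral_indicator h, lintegral_const, Measure.restrict_apply_univ]

/-! ### Bounds on the payment of a single type -/

namespace Mechanism

open Strategy

variable {n : ℕ} (M : Mechanism n)

/-- The optimal utility is at least that of collecting a set of items at its item prices. -/
lemma value_add_payment_le (v : Valuation n) (C : Finset (Fin n))
    (hC : ∀ i ∈ C, M.itemPrice i ≠ ⊤) :
    (v.1 C : ℝ≥0∞) + M.payment v ≤
      (M.choice v).expectedValue v + ∑ i ∈ C, M.itemPrice i := by
  classical
  -- The infimum in `itemPrice` need not be attained, hence the slack `η`, sent to zero at the end.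
  have key : ∀ η : ℝ≥0, 0 < η → (v.1 C : ℝ≥0∞) + M.payment v ≤
      (M.choice v).expectedValue v + ∑ i ∈ C, M.itemPrice i + C.card * η := by
    intro η hη
    have h1 : ∀ i : Fin n, ∃ l : Lottery n, i ∈ C → l ∈ M.menu ∧ l.prob i ≠ 0 ∧
        l.price ≤ (M.itemPrice i + η) * l.prob i := by
      intro i
      by_cases hi : i ∈ C
      · obtain ⟨l, hl, h⟩ := M.exists_lottery_of_itemPrice_lt i
          (ENNReal.lt_add_right (hC i hi) (ENNReal.coe_ne_zero.2 hη.ne'))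
        exact ⟨l, fun _ => ⟨hl, h⟩⟩
      · exact ⟨bundleLottery n 0, fun h => absurd h hi⟩
    choose l hl using h1
    have h2 : (collect C l).BuysFrom M.menu := by
      intro h l' hl'
      by_cases hne : (C \ h.items).Nonempty
      · have hs : l ((C \ h.items).min' hne) = l' := by simpa [collect, hne] using hl'
        rw [← hs]
        exact (hl _ (Finset.mem_sdiff.1 ((C \ h.items).min'_mem hne)).1).1
      · simp [collect, hne] at hl'
    have h3 := M.expectedValue_add_payment_le v h2
    have h4 := le_collect_expectedValue v C l fun i hi => (hl i hi).2.1
    have h5 := collect_expectedPayment_le C l _ fun i hi => (hl i hi).2.2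
    rw [Finset.sum_add_distrib, Finset.sum_const, nsmul_eq_mul] at h5
    rw [add_assoc]
    exact (add_le_add_left h4 _).trans (h3.trans (add_le_add_right h5 _))
  have h6 : Filter.Tendsto (fun η : ℝ≥0 => (M.choice v).expectedValue v +
      ∑ i ∈ C, M.itemPrice i + C.card * (η : ℝ≥0∞)) (nhdsWithin 0 (Set.Ioi 0))
      (nhds ((M.choice v).expectedValue v + ∑ i ∈ C, M.itemPrice i + C.card * (0 : ℝ≥0))) := by
    refine Filter.Tendsto.const_add _ (ENNReal.Tendsto.const_mul ?_ (Or.inr (by simp)))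
    exact (ENNReal.tendsto_coe.2 Filter.tendsto_id).mono_left nhdsWithin_le_nhds
  simpa using ge_of_tendsto h6 (Filter.eventually_of_mem self_mem_nhdsWithin key)

/-- If all items outside `C` are expensive compared to the total value, then the payment is at most
twice the item prices of `C`. -/
lemma payment_le_two_mul_sum (v : Valuation n) (C : Finset (Fin n))
    (hC : ∀ i ∈ C, M.itemPrice i ≠ ⊤)
    (hexp : ∀ i ∉ C, 2 * (n : ℝ≥0∞) * v.1 Finset.univ ≤ M.itemPrice i) (hn : n ≠ 0) :
    M.payment v ≤ 2 * ∑ i ∈ C, M.itemPrice i := by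
  set V : ℝ≥0∞ := (v.1 Finset.univ : ℝ≥0∞) with hV
  set p := M.payment v with hp
  have hptop : p ≠ ⊤ := M.payment_ne_top v
  set A := M.choice v with hA
  -- Each item outside `C` is held with probability at most `p / (2nV)`, and holding any of them
  -- adds at most `V`; so they contribute at most `p / 2` in total.
  have h1 : 2 * A.expectedValue v ≤ 2 * (v.1 C : ℝ≥0∞) + p := by
    rw [expectedValue_eq, ENNReal.mul_iSup]
    refine iSup_le fun k => ?_
    have h2 : pmfExp (A.run k) (fun h => (v.1 h.items : ℝ≥0∞)) ≤
        v.1 C + ∑ i ∈ Cᶜ, V * pmfExp (A.run k) (fun h => if i ∈ h.items then 1 else 0) := by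
      simp only [← pmfExp_const_mul]
      rw [← pmfExp_const (A.run k) (v.1 C : ℝ≥0∞), ← pmfExp_finsetSum, ← pmfExp_add]
      refine pmfExp_mono _ fun h => ?_
      by_cases hsub : h.items ⊆ C
      · have : v.1 h.items ≤ v.1 C := v.2.1 hsub
        exact le_add_right (by exact_mod_cast this)
      · obtain ⟨i, hi, hiC⟩ := Finset.not_subset.1 hsub
        have : v.1 h.items ≤ v.1 Finset.univ := v.2.1 (Finset.subset_univ _)
        have h3 : (v.1 h.items : ℝ≥0∞) ≤ V * (if i ∈ h.items then 1 else 0) := by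
          rw [if_pos hi, mul_one, hV]
          exact_mod_cast this
        exact le_add_left (h3.trans (Finset.single_le_sum
          (f := fun i => V * (if i ∈ h.items then 1 else 0)) (fun _ _ => zero_le)
          (Finset.mem_compl.2 hiC)))
    have h4 : ∀ i ∈ Cᶜ, 2 * (n : ℝ≥0∞) *
        (V * pmfExp (A.run k) (fun h => if i ∈ h.items then 1 else 0)) ≤ p := by
      intro i hi
      rw [← mul_assoc]
      exact mul_pmfExp_mem_le M (M.choice_buysFrom v) i (hexp i (Finset.mem_compl.1 hi)) k
    have h5 := Finset.sum_le_card_nsmul _ _ _ h4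
    rw [← Finset.mul_sum, nsmul_eq_mul] at h5
    have h6 : ((Cᶜ.card : ℕ) : ℝ≥0∞) ≤ n := by
      exact_mod_cast (Finset.card_le_univ _).trans_eq (Fintype.card_fin n)
    have h7 : (n : ℝ≥0∞) * (2 * ∑ i ∈ Cᶜ,
        V * pmfExp (A.run k) (fun h => if i ∈ h.items then 1 else 0)) ≤ n * p := by
      refine le_trans (le_of_eq (by ring)) (h5.trans ?_)
      gcongr
    have h8 := (ENNReal.mul_le_mul_iff_right (by simpa using hn) (by simp)).1 h7
    refine (mul_le_mul_right h2 2).trans ?_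
    rw [mul_add]
    gcongr
  have h9 := mul_le_mul_right (M.value_add_payment_le v C hC) 2
  rw [mul_add, mul_add] at h9
  have h10 : 2 * (v.1 C : ℝ≥0∞) + p + p ≤ 2 * (v.1 C : ℝ≥0∞) + p + 2 * ∑ i ∈ C, M.itemPrice i := by
    refine le_trans (le_of_eq (by ring)) (h9.trans ?_)
    gcongr
  exact (ENNReal.add_le_add_iff_left (ENNReal.add_ne_top.2
    ⟨ENNReal.mul_ne_top (by simp) ENNReal.coe_ne_top, hptop⟩)).1 h10

/-- Lowering all prices by the factor `1 - δ` makes a perturbed type pay almost as much. -/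
lemma payment_le_payment_scale_add {ε δ : ℝ} (hε : 0 ≤ ε) (hε1 : ε ≤ 1) (hδ : 0 < δ) (hδ1 : δ < 1)
    {v v' : Valuation n}
    (hv : ∀ S, (1 - ε) * (v.1 S : ℝ) ≤ v'.1 S ∧ (v'.1 S : ℝ) ≤ (1 + ε) * v.1 S) :
    M.payment v ≤ M.payment (v'.scale (1 - δ).toNNReal⁻¹) +
      ENNReal.ofReal (2 * ε / δ) * v.1 Finset.univ := by
  set α := (1 - δ).toNNReal with hα
  have hαr : (α : ℝ) = 1 - δ := Real.coe_toNNReal _ (by linarith)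
  have hα0 : α ≠ 0 := by
    intro h
    rw [h] at hαr
    simp only [NNReal.coe_zero] at hαr
    linarith
  set w := v'.scale α⁻¹ with hw
  set A := M.choice v with hA
  set B := M.choice w with hB
  -- Adding `o1` to `1 - δ` times `o2` cancels the values up to `ε (a + b) ≤ 2εV` and leaves `δ`
  -- times the difference of payments.
  have o1 := M.expectedValue_add_payment_le v (M.choice_buysFrom w)
  have o2 := M.expectedValue_add_payment_le w (M.choice_buysFrom v)
  have lower : ((1 - ε).toNNReal : ℝ≥0∞) * A.expectedValue v ≤ A.expectedValue v' := by
    rw [← expectedValue_scale]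
    refine (expectedValue_le_mul 1 (fun S => ?_) A).trans_eq (one_mul _)
    rw [one_mul, ← NNReal.coe_le_coe, Valuation.scale, NNReal.coe_mul,
      Real.coe_toNNReal _ (by linarith)]
    exact (hv S).1
  have upper : B.expectedValue v' ≤ ((1 + ε).toNNReal : ℝ≥0∞) * B.expectedValue v := by
    refine expectedValue_le_mul _ (fun S => ?_) B
    rw [← NNReal.coe_le_coe, NNReal.coe_mul, Real.coe_toNNReal _ (by linarith)]
    exact (hv S).2
  have hAV := expectedValue_le v A
  have hBV := expectedValue_le v B
  rw [hw, expectedValue_scale, expectedValue_scale] at o2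
  change B.expectedValue v + M.payment v ≤ A.expectedValue v + M.payment w at o1
  change ↑α⁻¹ * A.expectedValue v' + M.payment w ≤ ↑α⁻¹ * B.expectedValue v' + M.payment v at o2
  have hp := M.payment_ne_top v
  have hq := M.payment_ne_top w
  have ha := expectedValue_ne_top v A
  have hb := expectedValue_ne_top v B
  have ha' := expectedValue_ne_top v' A
  have hb' := expectedValue_ne_top v' B
  generalize M.payment v = p at *
  generalize M.payment w = q at *
  generalize A.expectedValue v = a at *
  generalize B.expectedValue v = b at *
  generalize A.expectedValue v' = a' at *
  generalize B.expectedValue v' = b' at *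
  generalize v.1 Finset.univ = V at *
  lift p to ℝ≥0 using hp
  lift q to ℝ≥0 using hq
  lift a to ℝ≥0 using ha
  lift b to ℝ≥0 using hb
  lift a' to ℝ≥0 using ha'
  lift b' to ℝ≥0 using hb'
  have hk : ((2 * ε / δ).toNNReal : ℝ) = 2 * ε / δ := Real.coe_toNNReal _ (by positivity)
  rw [ENNReal.ofReal]
  norm_cast at *
  rw [← NNReal.coe_le_coe] at *
  push_cast at *
  rw [Real.coe_toNNReal _ (by linarith)] at lower upper
  rw [hαr] at o2
  rw [hk]
  have hα' : 0 < 1 - δ := by linarith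
  have o2' : (a' : ℝ) + (1 - δ) * q ≤ b' + (1 - δ) * p := by
    have := mul_le_mul_of_nonneg_left o2 hα'.le
    field_simp at this
    linarith
  have h1 : ε * (a : ℝ) ≤ ε * V := mul_le_mul_of_nonneg_left hAV hε
  have h2 : ε * (b : ℝ) ≤ ε * V := mul_le_mul_of_nonneg_left hBV hε
  have h3 : δ * ((p : ℝ) - q) ≤ 2 * ε * V := by linarith
  have h4 : (p : ℝ) - q ≤ 2 * ε * V / δ := by
    rw [le_div_iff₀ hδ]
    linarith
  have h5 : 2 * ε * (V : ℝ) / δ = 2 * ε / δ * V := by ring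
  linarith

/-- Types whose total value is comparable to some item price are handled by lowering the prices,
the other ones pay little. -/
lemma payment_le_payment_scale_add_sum {ε δ : ℝ} (hε : 0 ≤ ε) (hε1 : ε ≤ 1) (hδ : 0 < δ)
    (hδ1 : δ < 1) (hn : n ≠ 0) {k : ℝ≥0∞} {v v' : Valuation n}
    (hv : ∀ S, (1 - ε) * (v.1 S : ℝ) ≤ v'.1 S ∧ (v'.1 S : ℝ) ≤ (1 + ε) * v.1 S) :
    M.payment v ≤ M.payment (v'.scale (1 - δ).toNNReal⁻¹) +
      ∑ i with M.itemPrice i ≠ ⊤,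
        (ENNReal.ofReal (2 * ε / δ) * k *
            (if M.itemPrice i ≤ 2 * n * v.1 Finset.univ then M.itemPrice i else 0) +
          2 * (if k * M.itemPrice i ≤ v.1 Finset.univ then M.itemPrice i else 0)) := by
  set V : ℝ≥0∞ := (v.1 Finset.univ : ℝ≥0∞) with hV
  -- If no item price is comparable to `V`, each item is either expensive enough for
  -- `payment_le_two_mul_sum` or cheaper than `V / k`.
  by_cases hrel : ∃ i, M.itemPrice i ≤ 2 * n * V ∧ V ≤ k * M.itemPrice i
  · obtain ⟨i, hi, hi'⟩ := hrel
    refine (M.payment_le_payment_scale_add hε hε1 hδ hδ1 hv).trans (add_le_add_right ?_ _)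
    have hfin : M.itemPrice i ≠ ⊤ := ne_top_of_le_ne_top (by simp [hV, ENNReal.mul_eq_top]) hi
    refine le_trans ?_ (Finset.single_le_sum (fun _ _ => zero_le)
      (Finset.mem_filter.2 ⟨Finset.mem_univ i, hfin⟩))
    rw [if_pos hi, mul_assoc]
    exact le_add_right (mul_le_mul_right hi' _)
  · push Not at hrel
    refine le_trans ?_ le_add_self
    have hfin : ∀ i, M.itemPrice i ≤ 2 * n * V → M.itemPrice i ≠ ⊤ := fun i hi =>
      ne_top_of_le_ne_top (by simp [hV, ENNReal.mul_eq_top]) hi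
    refine (M.payment_le_two_mul_sum v ({i | M.itemPrice i ≤ 2 * n * V} : Finset (Fin n))
      (fun i hi => hfin i (Finset.mem_filter.1 hi).2) (fun i hi => ?_) hn).trans ?_
    · simpa using (not_le.1 (fun h => hi (by simpa using h))).le
    · rw [Finset.mul_sum]
      refine (Finset.sum_le_sum fun i hi => ?_).trans
        (Finset.sum_le_sum_of_subset fun i hi => ?_)
      · have h := hrel i (Finset.mem_filter.1 hi).2
        rw [if_pos h.le]
        exact le_add_self
      · simpa using hfin i (Finset.mem_filter.1 hi).2

end Mechanism

/-! ### Integration over the coupling -/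

variable {n : ℕ}

/-- The tail of the total value is controlled by the optimal revenue of a perturbation. -/
lemma lintegral_tail_le {ε : ℝ} (hε : ε ≤ 1 / 2) {D' : Measure (Valuation n)}
    {π : Measure (Valuation n × Valuation n)} (hπ' : π.map Prod.snd = D')
    (hπ : ∀ᵐ z ∂π, ∀ S : Finset (Fin n),
      (1 - ε) * (z.1.1 S : ℝ) ≤ (z.2.1 S : ℝ) ∧ (z.2.1 S : ℝ) ≤ (1 + ε) * (z.1.1 S : ℝ))
    {a b : ℝ≥0} (hb : b ≠ 0) :
    ∫⁻ z, (if (a : ℝ≥0∞) ≤ b * z.1.1 Finset.univ then (a : ℝ≥0∞) else 0) ∂π ≤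
      2 * b * buyManyRev D' := by
  -- Since `ε ≤ 1/2`, `v([n]) ≥ a / b` forces `v'([n]) ≥ a / (2b)`, so the bundle price `t` applies
  -- to `D'`.
  set t : ℝ≥0 := a / (2 * b) with ht
  have hat : (a : ℝ≥0∞) = 2 * b * t := by
    rw [ht]
    norm_cast
    field_simp
  have hm : MeasurableSet {v : Valuation n | t ≤ v.1 Finset.univ} :=
    measurableSet_le measurable_const (Valuation.measurable_apply _)
  have h1 : ∫⁻ z, (if (a : ℝ≥0∞) ≤ b * z.1.1 Finset.univ then (a : ℝ≥0∞) else 0) ∂π ≤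
      ∫⁻ z, {v : Valuation n | t ≤ v.1 Finset.univ}.indicator (fun _ => (a : ℝ≥0∞)) z.2 ∂π := by
    refine lintegral_mono_ae ?_
    filter_upwards [hπ] with z hz
    split_ifs with h
    · rw [Set.indicator_of_mem]
      change t ≤ z.2.1 Finset.univ
      have h2 : a ≤ b * z.1.1 Finset.univ := by exact_mod_cast h
      have h3 := (hz Finset.univ).1
      rw [← NNReal.coe_le_coe] at h2 ⊢
      push_cast at h2
      have hb' : (0 : ℝ) < b := by positivity
      rw [ht, NNReal.coe_div, NNReal.coe_mul, div_le_iff₀ (by positivity)]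
      have h4 : (1 / 2) * (z.1.1 Finset.univ : ℝ) ≤ z.2.1 Finset.univ :=
        (mul_le_mul_of_nonneg_right (by linarith) (NNReal.coe_nonneg _)).trans h3
      push_cast
      nlinarith
    · exact zero_le
  refine h1.trans ?_
  rw [← lintegral_map (f := {v : Valuation n | t ≤ v.1 Finset.univ}.indicator
    (fun _ => (a : ℝ≥0∞))) (measurable_const.indicator hm) measurable_snd, hπ',
    lintegral_indicator hm, lintegral_const, Measure.restrict_apply_univ, hat, mul_assoc]
  exact mul_le_mul_right (mul_measure_le_buyManyRev D' t) _

lemma revenue_le_buyManyRev_add {ε δ : ℝ} (hε : 0 ≤ ε) (hε1 : ε ≤ 1 / 2) (hδ : 0 < δ)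
    (hδ1 : δ < 1) (hn : n ≠ 0) (hδε : ε * (n : ℝ) ^ 3 ≤ δ ^ 3) {D D' : Measure (Valuation n)}
    (h : IsMultiplicativePerturbation ε D D') (M : Mechanism n) :
    ENNReal.ofReal (1 - δ) * M.revenue D ≤ ENNReal.ofReal (1 + 12 * δ) * buyManyRev D' := by
  obtain ⟨π, hπ1, hπ2, hπ⟩ := h
  set R := buyManyRev D' with hR
  set α := (1 - δ).toNNReal with hα
  have hα0 : α ≠ 0 := by
    rw [hα, Ne, Real.toNNReal_eq_zero]
    linarith
  -- Summed over `n` items, the two kinds of loss are `8εn²k/δ` and `4n/k`. This `k` makes the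
  -- second `4δ` and the first `8εn³/δ² ≤ 8δ`, whence `12δ`.
  set k : ℝ≥0 := (n / δ).toNNReal with hk
  have hn' : (0 : ℝ) < n := by positivity
  have hkr : (k : ℝ) = n / δ := Real.coe_toNNReal _ (by positivity)
  have hk0 : k ≠ 0 := by
    rw [hk, Ne, Real.toNNReal_eq_zero]
    have : 0 < n / δ := by positivity
    linarith
  have hmeas : Measurable fun v : Valuation n => M.payment (v.scale α⁻¹) :=
    M.measurable_payment.comp (Valuation.measurable_scale _)
  have hval : Measurable fun z : Valuation n × Valuation n => (z.1.1 Finset.univ : ℝ≥0∞) :=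
    ((Valuation.measurable_apply _).comp measurable_fst).coe_nnreal_ennreal
  have hrev : M.revenue D = ∫⁻ z, M.payment z.1 ∂π := by
    rw [Mechanism.revenue, ← hπ1, lintegral_map M.measurable_payment measurable_fst]
    rfl
  have hmeas2 : Measurable fun z : Valuation n × Valuation n => M.payment (z.2.scale α⁻¹) :=
    hmeas.comp measurable_snd
  have hscale : ENNReal.ofReal (1 - δ) * ∫⁻ z, M.payment (z.2.scale α⁻¹) ∂π ≤ R := by
    refine le_trans (le_of_eq ?_)
      (le_iSup (fun M : Mechanism n => M.revenue D') (M.scale α hα0))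
    change _ = ∫⁻ v, (M.scale α hα0).payment v ∂D'
    simp only [Mechanism.payment_scale]
    rw [lintegral_const_mul _ hmeas, ← hπ2, lintegral_map hmeas measurable_snd]
    rfl
  have hterm : ∀ i ∈ ({i | M.itemPrice i ≠ ⊤} : Finset (Fin n)),
      ∫⁻ z, (ENNReal.ofReal (2 * ε / δ) * k *
            (if M.itemPrice i ≤ 2 * n * z.1.1 Finset.univ then M.itemPrice i else 0) +
          2 * (if k * M.itemPrice i ≤ z.1.1 Finset.univ then M.itemPrice i else 0)) ∂π ≤
        (ENNReal.ofReal (2 * ε / δ) * k * (4 * n) + 4 * (k⁻¹ : ℝ≥0)) * R := by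
    intro i hi
    have hfin : M.itemPrice i ≠ ⊤ := (Finset.mem_filter.1 hi).2
    lift M.itemPrice i to ℝ≥0 using hfin with a
    have m1 : Measurable fun z : Valuation n × Valuation n =>
        if (a : ℝ≥0∞) ≤ 2 * n * z.1.1 Finset.univ then (a : ℝ≥0∞) else 0 :=
      Measurable.ite (measurableSet_le measurable_const (hval.const_mul _))
        measurable_const measurable_const
    have m2 : Measurable fun z : Valuation n × Valuation n =>
        if k * (a : ℝ≥0∞) ≤ z.1.1 Finset.univ then (a : ℝ≥0∞) else 0 :=
      Measurable.ite (measurableSet_le measurable_const hval) measurable_const measurable_const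
    rw [lintegral_add_left (m1.const_mul _), lintegral_const_mul _ m1, lintegral_const_mul _ m2,
      add_mul]
    have t1 := lintegral_tail_le hε1 hπ2 hπ (a := a) (b := 2 * n) (by positivity)
    have t2 := lintegral_tail_le hε1 hπ2 hπ (a := a) (b := k⁻¹) (inv_ne_zero hk0)
    have e2 : ∀ x : ℝ≥0, ((a : ℝ≥0∞) ≤ (k⁻¹ : ℝ≥0) * x) ↔ (k : ℝ≥0∞) * a ≤ x := by
      intro x
      norm_cast
      rw [le_inv_mul_iff₀ (pos_iff_ne_zero.2 hk0)]
    simp only [e2] at t2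
    push_cast at t1
    refine add_le_add ?_ ?_
    · rw [mul_assoc (ENNReal.ofReal _ * _)]
      refine mul_le_mul_right (t1.trans_eq ?_) _
      ring
    · refine (mul_le_mul_right t2 2).trans_eq ?_
      ring
  have hmain : M.revenue D ≤ ∫⁻ z, M.payment (z.2.scale α⁻¹) ∂π + ENNReal.ofReal (12 * δ) * R := by
    rw [hrev]
    refine (lintegral_mono_ae (hπ.mono fun z hz =>
      M.payment_le_payment_scale_add_sum hε (by linarith) hδ hδ1 hn (k := k) hz)).trans ?_
    rw [lintegral_add_left hmeas2, lintegral_finsetSum]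
    · refine add_le_add_right ((Finset.sum_le_card_nsmul _ _ _ hterm).trans ?_) _
      rw [nsmul_eq_mul, ← mul_assoc]
      refine mul_le_mul_left ?_ _
      have hc : ((Finset.card {i | M.itemPrice i ≠ ⊤} : ℕ) : ℝ≥0∞) ≤ n := by
        exact_mod_cast (Finset.card_le_univ _).trans_eq (Fintype.card_fin n)
      refine (mul_le_mul_left hc _).trans ?_
      have hnum : (n : ℝ≥0) * ((2 * ε / δ).toNNReal * k * (4 * n) + 4 * k⁻¹) ≤
          (12 * δ).toNNReal := by
        rw [← NNReal.coe_le_coe]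
        push_cast
        rw [hkr, Real.coe_toNNReal _ (by positivity), Real.coe_toNNReal _ (by positivity)]
        have e : (n : ℝ) * (2 * ε / δ * (n / δ) * (4 * n) + 4 * (n / δ)⁻¹) =
            8 * (ε * n ^ 3) / δ ^ 2 + 4 * δ := by
          field_simp
          ring
        have e' : 8 * (ε * (n : ℝ) ^ 3) / δ ^ 2 ≤ 8 * δ := by
          rw [div_le_iff₀ (by positivity)]
          nlinarith
        rw [e]
        linarith
      have := ENNReal.coe_le_coe.2 hnum
      push_cast at this
      exact this
    · intro i _
      refine Measurable.add (Measurable.const_mul (Measurable.ite (measurableSet_le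
        measurable_const (hval.const_mul _)) measurable_const measurable_const) _)
        (Measurable.const_mul (Measurable.ite (measurableSet_le measurable_const hval)
          measurable_const measurable_const) _)
  refine (mul_le_mul_right hmain _).trans ?_
  rw [mul_add]
  refine (add_le_add hscale (mul_le_mul_left (b := ENNReal.ofReal (1 - δ)) (c := 1)
    (by simpa using hδ.le) _)).trans_eq ?_
  rw [ENNReal.ofReal_add (by norm_num) (by positivity), ENNReal.ofReal_one, one_mul, add_mul,
    one_mul]

lemma ofReal_mul_buyManyRev_le {ε δ : ℝ} (hε : 0 ≤ ε) (hε1 : ε ≤ 1 / 2) (hδ : 0 < δ)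
    (hδ1 : δ < 1) (hn : n ≠ 0) (hδε : ε * (n : ℝ) ^ 3 ≤ δ ^ 3) {D D' : Measure (Valuation n)}
    (h : IsMultiplicativePerturbation ε D D') :
    ENNReal.ofReal (1 - 13 * δ) * buyManyRev D ≤ buyManyRev D' := by
  have h1 : ENNReal.ofReal (1 - δ) * buyManyRev D ≤
      ENNReal.ofReal (1 + 12 * δ) * buyManyRev D' := by
    conv_lhs => rw [buyManyRev, ENNReal.mul_iSup]
    exact iSup_le fun M => revenue_le_buyManyRev_add hε hε1 hδ hδ1 hn hδε h M
  have hp : 0 < 1 + 12 * δ := by linarith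
  rw [← ENNReal.mul_le_mul_iff_right (ENNReal.ofReal_pos.2 hp).ne' ENNReal.ofReal_ne_top]
  refine le_trans ?_ h1
  rw [← mul_assoc, ← ENNReal.ofReal_mul hp.le]
  -- `(1 + 12δ)(1 - 13δ) = 1 - δ - 156δ² ≤ 1 - δ`.
  exact mul_le_mul_left (ENNReal.ofReal_le_ofReal (by nlinarith)) _

lemma IsMultiplicativePerturbation.eq_of_zero {D D' : Measure (Valuation n)}
    (h : IsMultiplicativePerturbation 0 D D') : D = D' := by
  obtain ⟨π, rfl, rfl, hπ⟩ := h
  refine Measure.map_congr (hπ.mono fun z hz => Subtype.ext (funext fun S => ?_))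
  have := hz S
  rw [sub_zero, add_zero, one_mul] at this
  exact NNReal.coe_injective (le_antisymm this.1 this.2)

end BuyMany

end

/-! ### Choice of the parameters -/

theorem mainTheorem1 :
    ∃ C : ℝ, 0 < C ∧
      ∀ (n : ℕ), 2 ≤ n → ∀ (ε : ℝ), 0 ≤ ε →
        ∀ (D D' : Measure (BuyMany.Valuation n)) [IsProbabilityMeasure D]
          [IsProbabilityMeasure D'],
          BuyMany.IsMultiplicativePerturbation ε D D' →
            ENNReal.ofReal
                (1 - C * (ε ^ (1 / 6 : ℝ) * (n : ℝ) ^ (1 / 2 : ℝ) *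
                  (Real.log n) ^ (1 / 6 : ℝ))) * BuyMany.buyManyRev D
              ≤ BuyMany.buyManyRev D' := by
  -- `26 = 2 · 13`: the factor `(log n)^(1/6)` is only used through its lower bound `1/2`.
  refine ⟨26, by norm_num, fun n hn ε hε D D' _ _ h => ?_⟩
  -- For `ε = 0` the choice of `δ` below would vanish, but then the distributions coincide.
  rcases hε.eq_or_lt with rfl | hε0
  · rw [h.eq_of_zero, Real.zero_rpow (by norm_num)]
    simp
  have hn2 : (2 : ℝ) ≤ n := by exact_mod_cast hn
  have hn0 : (0 : ℝ) < n := by linarith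
  set x : ℝ := ε ^ (1 / 6 : ℝ) * (n : ℝ) ^ (1 / 2 : ℝ) with hx
  have hx0 : 0 < x := by positivity
  have hx6 : x ^ 6 = ε * (n : ℝ) ^ 3 := by
    rw [hx, mul_pow, ← Real.rpow_natCast, ← Real.rpow_mul hε, ← Real.rpow_natCast,
      ← Real.rpow_mul hn0.le, ← Real.rpow_natCast]
    norm_num
  have hlog : (1 / 2 : ℝ) ≤ Real.log n ^ (1 / 6 : ℝ) := by
    have h1 : (1 / 2 : ℝ) ≤ Real.log n :=
      (by linarith [Real.log_two_gt_d9] : (1 / 2 : ℝ) ≤ Real.log 2).trans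
        (Real.log_le_log (by norm_num) hn2)
    refine le_trans ?_ (Real.rpow_le_rpow (by norm_num) h1 (by norm_num))
    exact Real.self_le_rpow_of_le_one (by norm_num) (by norm_num) (by norm_num)
  have hle : ENNReal.ofReal (1 - 26 * (x * Real.log n ^ (1 / 6 : ℝ))) ≤
      ENNReal.ofReal (1 - 13 * x) := ENNReal.ofReal_le_ofReal (by nlinarith)
  refine (mul_le_mul_left hle _).trans ?_
  rcases le_or_gt 1 (13 * x) with h1 | h1
  · rw [ENNReal.ofReal_of_nonpos (by linarith), zero_mul]
    exact zero_le
  have hx1 : x < 1 := by linarith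
  have hxx : x ^ 2 ≤ x := by nlinarith
  have hε1 : ε ≤ 1 / 2 := by
    have h2 : (1 : ℝ) ≤ (n : ℝ) ^ 3 := one_le_pow₀ (by linarith)
    have h3 : x ^ 6 ≤ x := by
      simpa using pow_le_pow_of_le_one hx0.le hx1.le (show 1 ≤ 6 by norm_num)
    nlinarith
  -- Here `δ = x²`, so that `δ³ = x⁶ = εn³`; the factor `1 - 13x²` is at least `1 - 13x` because `x
  -- < 1`.
  refine le_trans (mul_le_mul_left (ENNReal.ofReal_le_ofReal ?_) _)
    (BuyMany.ofReal_mul_buyManyRev_le hε hε1 (pow_pos hx0 2) (by linarith) (by omega) ?_ h)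
  · linarith
  · rw [← hx6]
    exact le_of_eq (by ring)
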